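/- Let $m\ge 1$, let $p\in\mathbb{R}^m$ satisfy $p_i>0$ for all $i\in[m]=\{1,\dots,m\}$ and $\sum_{i=1}^m p_i=1$, and let $r>0$. Let $\phi:[0,\infty)\to\mathbb{R}$ be convex with $\phi(1)=0$, and let $h:[0,1]\to[0,1]$ be a concave distortion function, i.e. $h$ is concave and non-decreasing with $h(0)=0$ and $h(1)=1$. Let $u:\mathbb{R}\to\mathbb{R}$, $f:\mathbb{R}^{n_a}\times\mathbb{R}^l\to\mathbb{R}$ and $x_1,\dots,x_m\in\mathbb{R}^l$. Define $$\mathcal U_{\phi,h}(p)=\Big\{(q,\bar q)\in\mathbb{R}^{2m}:\ q,\bar q\ge 0,\ \sum_{i=1}^m q_i=\sum_{i=1}^m\bar q_i=1,\ \sum_{i=1}^m p_i\phi\big(\tfrac{q_i}{p_i}\big)\le r,\ \sum_{i\in J}\bar q_i\le h\Big(\sum_{i\in J}q_i\Big)\ \forall J\subseteq[m]\Big\},$$ $$M_h(p)=\Big\{\bar q\in\mathbb{R}^{m}:\ \bar q\ge 0,\ \sum_{i=1}^m\bar q_i=1,\ \sum_{i\in J}\bar q_i\le h\Big(\sum_{i\in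 J}p_i\Big)\ \forall J\subseteq[m]\Big\}.$$ Let $I_1,\dots,I_{2^m-2}$ be an enumeration of all subsets of $[m]$ other than $\emptyset$ and $[m]$. Let $\phi^*(y)=\sup_{t\ge0}\{yt-\phi(t)\}$ and $(-h)^*(y)=\sup_{t\ge0}\{yt+h(t)\}$, where $h(t):=1$ for $t>1$; both take values in $(-\infty,\infty]$. For $g\in\{\phi^*,(-h)^*\}$, the expression $\lambda g(z/\lambda)$ at $\lambda=0$ is understood as $0$ if $z=0$ and as $+\infty$ if $z\ne0$. Then, for all $(a,c)\in\mathbb{R}^{n_a}\times\mathbb{R}$: (i) $\displaystyle\sup_{(q,\bar q)\in\mathcal U_{\phi,h}(p)}\sum_{i=1}^m-\bar q_i\,u(f(a,x_i))\le c$ holds if and only if there exist $\alpha,\beta,\gamma\in\mathbb{R}$ and $(\nu_j)_{j=1}^{2^m-2},(\lambda_j)_{j=1}^{2^m-2}\in\mathbb{R}^{2^m-2}$ such that $$\begin{cases}\alpha+\beta+\gamma r+\sum_{i=1}^m p_i\,\gamma\,\phi^*\Big(\frac{-\alpha+\sum_{j:\,i\in I_j}\nu_j}{\gamma}\Big)+\sum_{j=1}^{2^m-2}\lambda_j(-h)^*\Big(\frac{-\nu_j}{\lambda_j}\Big)\le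 c,\\ -u(f(a,x_i))-\beta-\sum_{j:\,i\in I_j}\lambda_j\le0\quad\forall i\in[m],\\ \gamma\ge 0,\ \lambda_j\ge0\quad\forall j\in[2^m-2].\end{cases}$$ (ii) $\displaystyle\sup_{\bar q\in M_h(p)}\sum_{i=1}^m-\bar q_i\,u(f(a,x_i))\le c$ holds if and only if there exist $\beta\in\mathbb{R}$ and $\lambda_1,\dots,\lambda_{2^m-2}\ge0$ such that $$\begin{cases}\beta+\sum_{j=1}^{2^m-2}\lambda_j\,h\big(\sum_{k\in I_j}p_k\big)\le c,\\ -u(f(a,x_i))-\beta-\sum_{j:\,i\in I_j}\lambda_j\le0\quad\forall i\in[m].\end{cases}$$ -/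

import Mathlib

open scoped BigOperators

noncomputable section

/-- A distortion function `h : [0,1] → [0,1]`: non-decreasing with `h 0 = 0` and `h 1 = 1`.
It is represented by a function on `ℝ` of which only the values on `[0,1]` matter. -/
structure IsDistortion (h : ℝ → ℝ) : Prop where
  mapsTo : Set.MapsTo h (Set.Icc 0 1) (Set.Icc 0 1)
  monotoneOn : MonotoneOn h (Set.Icc 0 1)
  map_zero : h 0 = 0
  map_one : h 1 = 1

/-- The extension of a distortion function to `[0,∞)` by the value `1` on `(1,∞)`. -/
def extendDistortion (h : ℝ → ℝ) (t : ℝ) : ℝ := if t ≤ 1 then h t else 1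

/-- A divergence function `φ : [0,∞) → ℝ`: convex with `φ 1 = 0`. It is represented by a
function on `ℝ` of which only the values on `[0,∞)` matter. -/
structure IsDivergenceFunction (φ : ℝ → ℝ) : Prop where
  convexOn : ConvexOn ℝ (Set.Ici 0) φ
  map_one : φ 1 = 0

/-- The convex conjugate `g*(y) = sup_{t ∈ D} (y t - g t)`, with values in `[-∞,∞]`, of a
function `g` with effective domain `D`. -/
def conjugate (D : Set ℝ) (g : ℝ → ℝ) (y : ℝ) : EReal :=
  ⨆ t ∈ D, ((y * t - g t : ℝ) : EReal)

/-- The perspective `(z, s) ↦ s g(z / s)` for `s > 0`, with the conventions `0` at `(0, 0)` and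
`∞` at `(z, 0)` with `z ≠ 0` (and, immaterially, `∞` for `s < 0`). -/
def perspective (g : ℝ → EReal) (z s : ℝ) : EReal :=
  if 0 < s then (s : EReal) * g (z / s) else if z = 0 ∧ s = 0 then 0 else ⊤

/-- The composite uncertainty set of pairs `(q, q̄)`, for a nominal vector `p` with positive
entries. -/
def compositeSet {m : ℕ} (φ h : ℝ → ℝ) (r : ℝ) (p : Fin m → ℝ) :
    Set ((Fin m → ℝ) × (Fin m → ℝ)) :=
  {z | ∑ i, z.1 i = 1 ∧ ∑ i, z.2 i = 1 ∧
    ∑ i, p i * φ (z.1 i / p i) ≤ r ∧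
    (∀ J : Finset (Fin m), ∑ i ∈ J, z.2 i ≤ h (∑ i ∈ J, z.1 i)) ∧
    ∀ i, 0 ≤ z.1 i ∧ 0 ≤ z.2 i}

/-- The set `M_h(p)` of probability vectors dominated by `h ∘ p`. -/
def distortionSet {m : ℕ} (h : ℝ → ℝ) (p : Fin m → ℝ) : Set (Fin m → ℝ) :=
  {q | ∑ i, q i = 1 ∧
    (∀ J : Finset (Fin m), ∑ i ∈ J, q i ≤ h (∑ i ∈ J, p i)) ∧
    ∀ i, 0 ≤ q i}

/-- The subsets of `[m]` other than the empty set and `[m]` itself. -/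
abbrev ProperSubset (m : ℕ) : Type :=
  {J : Finset (Fin m) // J ≠ ∅ ∧ J ≠ Finset.univ}

/-- For `m ≥ 1` there are exactly `2 ^ m - 2` such subsets, so they can be enumerated as
`I_1, …, I_{2^m-2}`. -/
theorem card_properSubset {m : ℕ} (hm : 0 < m) :
    Fintype.card (ProperSubset m) = 2 ^ m - 2 := by
  haveI : Nonempty (Fin m) := ⟨⟨0, hm⟩⟩
  have h1 : (Finset.univ.filter fun J : Finset (Fin m) => J ≠ ∅ ∧ J ≠ Finset.univ)
      = (Finset.univ.erase ∅).erase Finset.univ := by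
    ext J
    simp [and_comm]
  rw [Fintype.card_subtype, h1, Finset.card_erase_of_mem, Finset.card_erase_of_mem]
  · simp [Nat.sub_sub]
  · simp
  · simp [Finset.univ_nonempty.ne_empty]

end

open scoped BigOperators

/-! Write `w i` for `-u (f a (x i))`; both parts are strong Lagrange duality for a linear objective.
In (i), auxiliary variables equal to the sums of `q` over the proper subsets decouple `h` from `q`.
The Lagrangian is then separable, and its one-variable suprema are the perspectives of the
conjugates.

Slater's condition is the obstacle. A concave distortion either exceeds the identity on all of
`(0,1)` or equals it (`IsDistortion.lt_or_eq`). In the first case the nominal `p` is strictly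
feasible, and `exists_lagrange_multipliers` applies. In the second the constraints force `q̄ = q`;
the problem in `q` alone satisfies Slater's condition for (i), the feasible set in (ii) is `{p}`,
and weights on singletons supply the remaining multipliers.

The convention at multiplier `0` is stricter than the closure of the perspective. If `γ = 0`, every
`w i` is at most `c` and a trivial dual point works (`IsBoundedLagrangian.le_of_gamma_eq_zero`); if
`lam j = 0`, then `ν j` may be replaced by `0`. The converse implications are weak duality. -/

/-! ### Lagrange multipliers under Slater's condition -/

/-- Separate `(b, 0, 0)` from the image of the strict hypograph-epigraph set `T`. That image is open
because `A` is onto, so the separation is strict, and the Slater point makes the objective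
coefficient nonzero. The open orthant gives continuity of `f` and `g` for free. -/
theorem exists_lagrange_multipliers {ι ρ κ : Type*} [Fintype ι] [Fintype ρ] [Fintype κ]
    {f : (ι → ℝ) → ℝ} (hf : ConcaveOn ℝ {y : ι → ℝ | ∀ i, 0 < y i} f)
    {g : κ → (ι → ℝ) → ℝ} (hg : ∀ k, ConvexOn ℝ {y : ι → ℝ | ∀ i, 0 < y i} (g k))
    (A : (ι → ℝ) →ₗ[ℝ] (ρ → ℝ)) (hA : Function.Surjective A) (b : ρ → ℝ) (c : ℝ)
    {y₀ : ι → ℝ} (hy₀ : ∀ i, 0 < y₀ i) (hAy₀ : A y₀ = b) (hgy₀ : ∀ k, g k y₀ < 0)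
    (hc : ∀ y, (∀ i, 0 < y i) → A y = b → (∀ k, g k y < 0) → f y ≤ c) :
    ∃ (η : ρ → ℝ) (μ : κ → ℝ), (∀ k, 0 ≤ μ k) ∧
      ∀ y : ι → ℝ, (∀ i, 0 < y i) →
        f y - c ≤ ∑ j, η j * (A y j - b j) + ∑ k, μ k * g k y := by
  classical
  set D : Set (ι → ℝ) := {y | ∀ i, 0 < y i} with hD
  have hDo : IsOpen D := by
    have : D = Set.univ.pi fun _ => Set.Ioi 0 := by ext; simp [hD]
    rw [this]
    exact isOpen_set_pi Set.finite_univ fun _ _ => isOpen_Ioi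
  have hDc : Convex ℝ D := hf.1
  have hfc : ContinuousOn f D := hf.continuousOn hDo
  have hgc : ∀ k, ContinuousOn (g k) D := fun k => (hg k).continuousOn hDo
  let T : Set ((ι → ℝ) × (κ → ℝ) × ℝ) :=
    {z | z.1 ∈ D ∧ (∀ k, g k z.1 < z.2.1 k) ∧ z.2.2 < f z.1 - c}
  have hTo : IsOpen T := by
    have hDU : IsOpen (Prod.fst ⁻¹' D : Set ((ι → ℝ) × (κ → ℝ) × ℝ)) := hDo.preimage continuous_fst
    have h1 : ∀ k, IsOpen ((Prod.fst ⁻¹' D : Set ((ι → ℝ) × (κ → ℝ) × ℝ)) ∩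
        {z | g k z.1 - z.2.1 k < 0}) := fun k => by
      have : ContinuousOn (fun z : (ι → ℝ) × (κ → ℝ) × ℝ => g k z.1 - z.2.1 k)
          (Prod.fst ⁻¹' D) :=
        ((hgc k).comp continuousOn_fst fun _ hz => hz).sub (by fun_prop)
      exact this.isOpen_inter_preimage hDU isOpen_Iio
    have h2 : IsOpen ((Prod.fst ⁻¹' D : Set ((ι → ℝ) × (κ → ℝ) × ℝ)) ∩
        {z | z.2.2 - f z.1 < -c}) := by
      have : ContinuousOn (fun z : (ι → ℝ) × (κ → ℝ) × ℝ => z.2.2 - f z.1) (Prod.fst ⁻¹' D) :=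
        ContinuousOn.sub (by fun_prop) (hfc.comp continuousOn_fst fun _ hz => hz)
      exact this.isOpen_inter_preimage hDU isOpen_Iio
    have : T = (Prod.fst ⁻¹' D) ∩ ((⋂ k, ((Prod.fst ⁻¹' D) ∩ {z | g k z.1 - z.2.1 k < 0})) ∩
        ((Prod.fst ⁻¹' D) ∩ {z | z.2.2 - f z.1 < -c})) := by
      ext z
      simp only [T, Set.mem_ofPred_eq, Set.mem_inter_iff, Set.mem_iInter, Set.mem_preimage]
      constructor
      · rintro ⟨h1, h2, h3⟩
        exact ⟨h1, fun k => ⟨h1, by linarith [h2 k]⟩, h1, by linarith⟩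
      · rintro ⟨h1, h2, -, h3⟩
        exact ⟨h1, fun k => by linarith [(h2 k).2], by linarith⟩
    rw [this]
    exact hDU.inter ((isOpen_iInter_of_finite h1).inter h2)
  have hTc : Convex ℝ T := by
    rintro ⟨y, s, v⟩ ⟨hy, hs, hv⟩ ⟨y', s', v'⟩ ⟨hy', hs', hv'⟩ α β hα hβ hαβ
    refine ⟨hDc hy hy' hα hβ hαβ, fun k => ?_, ?_⟩
    · have h1 := (hg k).2 hy hy' hα hβ hαβ
      have h2 := hs k
      have h3 := hs' k
      simp only [smul_eq_mul, Prod.smul_mk, Prod.mk_add_mk, Pi.add_apply, Pi.smul_apply] at h1 h2 h3 ⊢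
      rcases hα.eq_or_lt with rfl | hα
      · obtain rfl : β = 1 := by linarith
        linarith
      · nlinarith [mul_lt_mul_of_pos_left h2 hα, mul_le_mul_of_nonneg_left h3.le hβ]
    · have h1 := hf.2 hy hy' hα hβ hαβ
      simp only [smul_eq_mul, Prod.smul_mk, Prod.mk_add_mk] at h1 hv hv' ⊢
      have e : c = α * c + β * c := by rw [← add_mul, hαβ, one_mul]
      rcases hα.eq_or_lt with rfl | hα
      · obtain rfl : β = 1 := by linarith
        linarith
      · nlinarith [mul_lt_mul_of_pos_left hv hα, mul_le_mul_of_nonneg_left hv'.le hβ]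
  let B : ((ι → ℝ) × (κ → ℝ) × ℝ) →ₗ[ℝ] ((ρ → ℝ) × (κ → ℝ) × ℝ) := A.prodMap LinearMap.id
  have hB : Function.Surjective B := by
    rintro ⟨w, s⟩
    obtain ⟨y, rfl⟩ := hA w
    exact ⟨(y, s), rfl⟩
  have hBo : IsOpenMap B := LinearMap.isOpenMap_of_finiteDimensional B hB
  have h0 : ((b, 0, 0) : (ρ → ℝ) × (κ → ℝ) × ℝ) ∉ B '' T := by
    rintro ⟨⟨y, s, v⟩, ⟨hy, hs, hv⟩, he⟩
    simp only [B, LinearMap.prodMap_apply, LinearMap.id_apply, Prod.mk.injEq] at he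
    obtain ⟨h1, rfl, rfl⟩ := he
    have := hc y hy h1 hs
    simp only at hv
    linarith
  obtain ⟨F, hF⟩ := geometric_hahn_banach_point_open (hTc.linear_image B) (hBo _ hTo) h0
  have dec : ∀ (w : ρ → ℝ) (s : κ → ℝ) (v : ℝ), F (w, s, v) =
      ∑ j, w j * F (Pi.single j 1, 0, 0) + ∑ k, s k * F (0, Pi.single k 1, 0)
        + v * F (0, 0, 1) := by
    intro w s v
    have e : ((w, s, v) : (ρ → ℝ) × (κ → ℝ) × ℝ) = ∑ j, w j • (Pi.single j 1, 0, 0)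
        + ∑ k, s k • (0, Pi.single k 1, 0) + v • (0, 0, 1) := by
      refine Prod.ext ?_ (Prod.ext ?_ ?_)
      · ext j; simp [Prod.fst_sum, Pi.single_apply]
      · ext j; simp [Prod.fst_sum, Prod.snd_sum, Pi.single_apply]
      · simp [Prod.snd_sum]
    rw [e]
    simp only [map_add, map_sum, map_smul, smul_eq_mul]
  set e : ρ → ℝ := fun j => F (Pi.single j 1, 0, 0)
  set d : κ → ℝ := fun k => F (0, Pi.single k 1, 0)
  set q : ℝ := F (0, 0, 1)
  have key : ∀ y ∈ D, ∀ (s : κ → ℝ) (v : ℝ), (∀ k, g k y < s k) → v < f y - c →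
      0 < ∑ j, (A y j - b j) * e j + ∑ k, s k * d k + v * q := by
    intro y hy s v hs hv
    have h1 := hF (A y, s, v) ⟨(y, s, v), ⟨hy, hs, hv⟩, rfl⟩
    rw [dec, dec] at h1
    simp only [Pi.zero_apply, zero_mul, Finset.sum_const_zero, add_zero] at h1
    simp only [sub_mul, Finset.sum_sub_distrib]
    change ∑ j, b j * e j < ∑ j, A y j * e j + ∑ k, s k * d k + v * q at h1
    linarith
  have hq : q < 0 := by
    -- At the Slater point with zero slack, only the objective term survives, and its value is
    -- negative.
    have h1 := key y₀ hy₀ 0 (min (f y₀ - c - 1) (-1)) hgy₀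
      (lt_of_le_of_lt (min_le_left _ _) (by linarith))
    rw [hAy₀] at h1
    simp only [sub_self, zero_mul, Finset.sum_const_zero, Pi.zero_apply, zero_add] at h1
    have h2 : min (f y₀ - c - 1) (-1) ≤ -1 := min_le_right _ _
    by_contra h3
    push Not at h3
    nlinarith
  have hd : ∀ k, 0 ≤ d k := by
    intro k
    by_contra h3
    push Not at h3
    set M : ℝ := (f y₀ - c - 1) * q
    -- If `d k < 0`, this slack contributes exactly `-|M|`, which cancels any gain from the
    -- objective term.
    have h1 := key y₀ hy₀ (Pi.single k (|M| / (-d k))) (f y₀ - c - 1)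
      (fun k' => lt_of_lt_of_le (hgy₀ k') (by
        by_cases h : k' = k
        · subst h
          simp only [Pi.single_eq_same]
          exact div_nonneg (abs_nonneg _) (by linarith)
        · simp [Pi.single_eq_of_ne h])) (by linarith)
    rw [hAy₀] at h1
    simp only [sub_self, zero_mul, Finset.sum_const_zero, zero_add, Pi.single_apply, ite_mul,
      Finset.sum_ite_eq', Finset.mem_univ, if_true] at h1
    have h4 : |M| / (-d k) * d k = -|M| := by
      rw [div_neg, neg_mul, div_mul_cancel₀ _ h3.ne]
    rw [h4] at h1
    have := le_abs_self M
    linarith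
  refine ⟨fun j => e j / (-q), fun k => d k / (-q), fun k => div_nonneg (hd k) (by linarith), ?_⟩
  intro y hy
  have hlim : ∀ ε : ℝ, 0 < ε → 0 < ∑ j, (A y j - b j) * e j + ∑ k, (g k y) * d k +
      (f y - c) * q + ε * (∑ k, d k - q) := by
    intro ε hε
    have h1 := key y hy (fun k => g k y + ε) (f y - c - ε) (fun k => by linarith) (by linarith)
    simp only [add_mul, Finset.sum_add_distrib, ← Finset.mul_sum] at h1
    linarith
  have h2 : 0 ≤ ∑ j, (A y j - b j) * e j + ∑ k, (g k y) * d k + (f y - c) * q := by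
    have hR : 0 < ∑ k, d k - q := by
      have := Finset.sum_nonneg fun k (_ : k ∈ Finset.univ) => hd k
      linarith
    by_contra h3
    push Not at h3
    set X := ∑ j, (A y j - b j) * e j + ∑ k, (g k y) * d k + (f y - c) * q
    have h4 := hlim (-X / (∑ k, d k - q)) (div_pos (by linarith) hR)
    rw [div_mul_cancel₀ _ hR.ne'] at h4
    linarith
  have h5 : ∑ j, e j / (-q) * (A y j - b j) + ∑ k, d k / (-q) * g k y
      = (∑ j, (A y j - b j) * e j + ∑ k, (g k y) * d k) / (-q) := by
    rw [add_div, Finset.sum_div, Finset.sum_div]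
    congr 1 <;> exact Finset.sum_congr rfl fun _ _ => by ring
  rw [h5, le_div_iff₀ (by linarith)]
  linarith

/-! ### Separable suprema -/

/-- Near-maximizers of the summands can be chosen independently, so the sum of the suprema is the
supremum of the sum. -/
theorem exists_upper_bounds_of_sum_le {ι : Type*} [Fintype ι] (F : ι → ℝ → ℝ) (C : ℝ)
    (h : ∀ y : ι → ℝ, (∀ i, 0 < y i) → ∑ i, F i (y i) ≤ C) :
    ∃ s : ι → ℝ, (∀ i t, 0 < t → F i t ≤ s i) ∧ ∑ i, s i ≤ C := by
  classical
  have hb : ∀ i, BddAbove (F i '' Set.Ioi 0) := by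
    intro i
    refine ⟨C - ∑ j ∈ Finset.univ.erase i, F j 1, ?_⟩
    rintro _ ⟨t, ht, rfl⟩
    have h1 := h (Function.update 1 i t) (fun j => by
      by_cases hj : j = i
      · subst hj; simpa using ht
      · simp [hj])
    rw [← Finset.add_sum_erase _ _ (Finset.mem_univ i)] at h1
    simp only [Function.update_self] at h1
    rw [Finset.sum_congr rfl (g := fun j => F j 1) fun j hj => by
      rw [Function.update_of_ne (Finset.ne_of_mem_erase hj), Pi.one_apply]] at h1
    linarith
  refine ⟨fun i => sSup (F i '' Set.Ioi 0), fun i t ht => le_csSup (hb i) ⟨t, ht, rfl⟩, ?_⟩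
  refine le_of_forall_pos_le_add fun ε hε => ?_
  have hn : (0 : ℝ) < Fintype.card ι + 1 := by positivity
  have h1 : ∀ i, ∃ t : ℝ, 0 < t ∧ sSup (F i '' Set.Ioi 0) - ε / (Fintype.card ι + 1) < F i t := by
    intro i
    obtain ⟨_, ⟨t, ht, rfl⟩, h2⟩ := exists_lt_of_lt_csSup
      (Set.Nonempty.image (F i) ⟨1, by simp⟩)
      (sub_lt_self (sSup (F i '' Set.Ioi 0)) (div_pos hε hn))
    exact ⟨t, ht, h2⟩
  choose t ht h2 using h1
  have h3 := Finset.sum_le_sum fun i (_ : i ∈ Finset.univ) => (h2 i).le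
  rw [Finset.sum_sub_distrib, Finset.sum_const, Finset.card_univ, nsmul_eq_mul] at h3
  have h4 : (Fintype.card ι : ℝ) * (ε / (Fintype.card ι + 1)) ≤ ε := by
    rw [mul_div_assoc', div_le_iff₀ hn]
    nlinarith
  linarith [h t ht]

/-- A concave function lies above its chord from `0` to `1`, so it cannot jump up at the endpoint
`0`. This extends bounds from the open orthant to its boundary. -/
theorem ConcaveOn.le_at_zero_of_forall_pos_le {F : ℝ → ℝ} (hF : ConcaveOn ℝ (Set.Ici 0) F) {s : ℝ}
    (h : ∀ t, 0 < t → F t ≤ s) : F 0 ≤ s := by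
  have h1 : ∀ t ∈ Set.Ioo (0 : ℝ) 1, (1 - t) * F 0 + t * F 1 ≤ s := by
    rintro t ⟨h0, h1⟩
    have := hF.2 (x := 0) (y := 1) (by simp) (by simp) (sub_nonneg.2 h1.le) h0.le (by ring)
    simp only [smul_eq_mul, mul_zero, mul_one, zero_add] at this
    exact this.trans (h t h0)
  have h2 : Filter.Tendsto (fun t : ℝ => (1 - t) * F 0 + t * F 1) (nhdsWithin 0 (Set.Ioi 0))
      (nhds ((1 - 0) * F 0 + 0 * F 1)) :=
    (Continuous.tendsto (by fun_prop) 0).mono_left nhdsWithin_le_nhds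
  have h3 := le_of_tendsto h2 (Filter.eventually_of_mem (Ioo_mem_nhdsGT one_pos) h1)
  simpa using h3

theorem exists_upper_bounds_of_concaveOn {ι : Type*} [Fintype ι] (F : ι → ℝ → ℝ) (C : ℝ)
    (hF : ∀ i, ConcaveOn ℝ (Set.Ici 0) (F i))
    (h : ∀ y : ι → ℝ, (∀ i, 0 < y i) → ∑ i, F i (y i) ≤ C) :
    ∃ s : ι → ℝ, (∀ i t, 0 ≤ t → F i t ≤ s i) ∧ ∑ i, s i ≤ C := by
  obtain ⟨s, hs, hsum⟩ := exists_upper_bounds_of_sum_le F C h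
  refine ⟨s, fun i t ht => ?_, hsum⟩
  rcases ht.eq_or_lt with rfl | ht
  · exact (hF i).le_at_zero_of_forall_pos_le (hs i)
  · exact hs i t ht

theorem nonpos_of_forall_mul_le {w s : ℝ} (h : ∀ t, 0 ≤ t → w * t ≤ s) : w ≤ 0 := by
  by_contra hw
  push Not at hw
  have h0 := h 0 le_rfl
  have h1 := h ((s + 1) / w) (div_nonneg (by linarith) hw.le)
  rw [mul_div_cancel₀ _ hw.ne'] at h1
  linarith

/-! ### Concave distortion functions -/

/-- Concavity puts `h` above the diagonal. If it were strictly above at `b`, the chords from `b` to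
both endpoints would keep it strictly above throughout `(0,1)`. -/
theorem IsDistortion.lt_or_eq {h : ℝ → ℝ} (hh : IsDistortion h)
    (hconc : ConcaveOn ℝ (Set.Icc 0 1) h) :
    (∀ s, 0 < s → s < 1 → s < h s) ∨ ∀ s, 0 ≤ s → s ≤ 1 → h s = s := by
  have hle : ∀ s, 0 ≤ s → s ≤ 1 → s ≤ h s := by
    intro s h0 h1
    have := hconc.2 (x := 0) (y := 1) (by simp) (by simp) (sub_nonneg.2 h1) h0 (by ring)
    simpa [hh.map_zero, hh.map_one] using this
  by_contra hcon
  push Not at hcon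
  obtain ⟨⟨a, ha0, ha1, ha⟩, b, hb0, hb1, hb⟩ := hcon
  have hb' : b < h b := lt_of_le_of_ne (hle b hb0 hb1) hb.symm
  have hb0' : 0 < b := hb0.lt_of_ne (by rintro rfl; exact hb hh.map_zero)
  have hb1' : b < 1 := hb1.lt_of_ne (by rintro rfl; exact hb hh.map_one)
  rcases lt_trichotomy a b with hab | rfl | hab
  · have := hconc.2 (x := 0) (y := b) (by simp) ⟨hb0, hb1⟩
      (sub_nonneg.2 ((div_le_one hb0').2 hab.le)) (div_pos ha0 hb0').le (by ring)
    simp only [smul_eq_mul, hh.map_zero, mul_zero, zero_add] at this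
    rw [div_mul_cancel₀ _ hb0'.ne'] at this
    have h2 : a / b * b < a / b * h b := mul_lt_mul_of_pos_left hb' (by positivity)
    rw [div_mul_cancel₀ _ hb0'.ne'] at h2
    linarith
  · linarith
  · have hd : 0 < 1 - b := by linarith
    have hw : 0 < (1 - a) / (1 - b) := div_pos (by linarith) hd
    have := hconc.2 (x := 1) (y := b) (by simp) ⟨hb0, hb1⟩
      (show 0 ≤ 1 - (1 - a) / (1 - b) from sub_nonneg.2 ((div_le_one hd).2 (by linarith)))
      hw.le (by ring)
    simp only [smul_eq_mul, hh.map_one, mul_one] at this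
    have e : 1 - (1 - a) / (1 - b) + (1 - a) / (1 - b) * b = a := by field_simp; ring
    rw [e] at this
    have h2 : (1 - a) / (1 - b) * b < (1 - a) / (1 - b) * h b := mul_lt_mul_of_pos_left hb' hw
    linarith

theorem IsDistortion.concaveOn_extendDistortion {h : ℝ → ℝ} (hh : IsDistortion h)
    (hconc : ConcaveOn ℝ (Set.Icc 0 1) h) : ConcaveOn ℝ (Set.Ici 0) (extendDistortion h) := by
  have hmin : ∀ t, 0 ≤ t → extendDistortion h t = h (min t 1) := by
    intro t _
    unfold extendDistortion
    split_ifs with h1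
    · rw [min_eq_left h1]
    · rw [min_eq_right (not_le.1 h1).le, hh.map_one]
  refine ⟨convex_Ici 0, fun x hx y hy a b ha hb hab => ?_⟩
  have hx' : 0 ≤ x := hx
  have hy' : 0 ≤ y := hy
  have hxy : 0 ≤ a • x + b • y := by simp only [smul_eq_mul]; positivity
  rw [hmin x hx, hmin y hy, hmin _ hxy]
  have hmx : min x 1 ∈ Set.Icc (0 : ℝ) 1 := ⟨le_min hx' zero_le_one, min_le_right _ _⟩
  have hmy : min y 1 ∈ Set.Icc (0 : ℝ) 1 := ⟨le_min hy' zero_le_one, min_le_right _ _⟩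
  refine (hconc.2 hmx hmy ha hb hab).trans
    (hh.monotoneOn (hconc.1 hmx hmy ha hb hab) ⟨le_min hxy zero_le_one, min_le_right _ _⟩ ?_)
  refine le_min ?_ (hconc.1 hmx hmy ha hb hab).2
  simp only [smul_eq_mul]
  gcongr <;> exact min_le_left _ _

/-! ### Perspectives of conjugates -/

/-- Fenchel–Young inequality; the conventions at `s = 0` preserve it. -/
theorem le_perspective_conjugate (D : Set ℝ) (g : ℝ → ℝ) {z s t : ℝ} (hs : 0 ≤ s) (ht : t ∈ D) :
    ((z * t - s * g t : ℝ) : EReal) ≤ perspective (conjugate D g) z s := by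
  unfold perspective
  split_ifs with h1 h2
  · have h3 : ((z / s * t - g t : ℝ) : EReal) ≤ conjugate D g (z / s) :=
      le_iSup₂ (f := fun t (_ : t ∈ D) => ((z / s * t - g t : ℝ) : EReal)) t ht
    have h4 : z * t - s * g t = s * (z / s * t - g t) := by field_simp
    rw [h4, EReal.coe_mul]
    exact mul_le_mul_of_nonneg_left h3 (EReal.coe_nonneg.2 hs)
  · simp [h2.1, h2.2]
  · exact le_top

theorem perspective_conjugate_le {D : Set ℝ} {g : ℝ → ℝ} {z s σ : ℝ} (hs : 0 < s)
    (h : ∀ t ∈ D, z * t - s * g t ≤ σ) : perspective (conjugate D g) z s ≤ (σ : EReal) := by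
  unfold perspective
  rw [if_pos hs]
  have h3 : conjugate D g (z / s) ≤ ((σ / s : ℝ) : EReal) := by
    refine iSup₂_le fun t ht => EReal.coe_le_coe_iff.2 ?_
    rw [le_div_iff₀ hs]
    refine le_trans (le_of_eq ?_) (h t ht)
    field_simp
  refine (mul_le_mul_of_nonneg_left h3 (EReal.coe_nonneg.2 hs.le)).trans (le_of_eq ?_)
  rw [← EReal.coe_mul, mul_div_cancel₀ _ hs.ne']

theorem perspective_zero_zero (g : ℝ → EReal) : perspective g 0 0 = 0 := by
  simp [perspective]

/-! ### Sums over subsets, convexity and feasibility -/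

theorem sum_mul_sum_eq_sum_mul_sum_filter {m N : ℕ} (I : Fin N → Finset (Fin m)) (ν : Fin N → ℝ)
    (q : Fin m → ℝ) :
    ∑ j, ν j * ∑ k ∈ I j, q k = ∑ i, q i * ∑ j with i ∈ I j, ν j := by
  have h1 : ∀ j, ν j * ∑ k ∈ I j, q k = ∑ i, if i ∈ I j then q i * ν j else 0 := fun j => by
    rw [← Finset.sum_filter, Finset.mul_sum, Finset.filter_mem_eq_inter, Finset.univ_inter]
    exact Finset.sum_congr rfl fun _ _ => mul_comm _ _
  simp_rw [h1]
  rw [Finset.sum_comm]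
  exact Finset.sum_congr rfl fun i _ => by rw [Finset.mul_sum, Finset.sum_filter]

/-- All the weight goes on singletons, which are proper subsets once `2 ≤ m`. -/
theorem exists_singleton_weights {m N : ℕ} (hm : 2 ≤ m) (I : Fin N ≃ ProperSubset m)
    {w : Fin m → ℝ} (hw : ∀ i, 0 ≤ w i) :
    ∃ lam : Fin N → ℝ, (∀ j, 0 ≤ lam j) ∧ ∀ i, ∑ j with i ∈ (I j).1, lam j = w i := by
  have hsing : ∀ i : Fin m, ({i} : Finset (Fin m)) ≠ ∅ ∧ ({i} : Finset (Fin m)) ≠ Finset.univ := by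
    refine fun i => ⟨Finset.singleton_ne_empty i, fun h => ?_⟩
    have := congrArg Finset.card h
    simp at this
    omega
  let e : Fin m → Fin N := fun i => I.symm ⟨{i}, hsing i⟩
  refine ⟨fun j => ∑ k, if e k = j then w k else 0,
    fun j => Finset.sum_nonneg fun k _ => by split_ifs; exacts [hw k, le_rfl], fun i => ?_⟩
  rw [Finset.sum_comm]
  simp [e]

theorem convex_setOf_forall_pos (ι : Type*) : Convex ℝ {y : ι → ℝ | ∀ i, 0 < y i} := by
  have : {y : ι → ℝ | ∀ i, 0 < y i} = Set.univ.pi fun _ => Set.Ioi 0 := by ext; simp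
  rw [this]
  exact convex_pi fun _ _ => convex_Ioi 0

theorem ConvexOn.comp_apply_of_pos {ι : Type*} {ψ : ℝ → ℝ} (hψ : ConvexOn ℝ (Set.Ici 0) ψ)
    (i : ι) : ConvexOn ℝ {y : ι → ℝ | ∀ i, 0 < y i} fun y => ψ (y i) :=
  (hψ.comp_linearMap (LinearMap.proj (R := ℝ) (φ := fun _ : ι => ℝ) i)).subset
    (fun _ hy => (hy i).le) (convex_setOf_forall_pos ι)

theorem convexOn_finset_sum {E κ : Type*} [AddCommGroup E] [Module ℝ E] {S : Set E}
    (hS : Convex ℝ S) {f : κ → E → ℝ} (s : Finset κ) (hf : ∀ k ∈ s, ConvexOn ℝ S (f k)) :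
    ConvexOn ℝ S fun y => ∑ k ∈ s, f k y := by
  classical
  induction s using Finset.induction_on with
  | empty => simpa using convexOn_const (0 : ℝ) hS
  | insert a s ha ih =>
    simp only [Finset.sum_insert ha]
    exact (hf a (Finset.mem_insert_self a s)).add
      (ih fun k hk => hf k (Finset.mem_insert_of_mem hk))

theorem convexOn_mul_apply {ι : Type*} {S : Set (ι → ℝ)} (hS : Convex ℝ S) (a : ℝ) (i : ι) :
    ConvexOn ℝ S fun y => y i * a := by
  refine ⟨hS, fun x _ y _ s t _ _ _ => le_of_eq ?_⟩
  simp only [Pi.add_apply, Pi.smul_apply, smul_eq_mul]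
  ring

theorem concaveOn_sum_mul_apply {ι κ : Type*} [Fintype κ] {S : Set (ι → ℝ)} (hS : Convex ℝ S)
    (a : κ → ℝ) (i : κ → ι) : ConcaveOn ℝ S fun y => ∑ k, y (i k) * a k := by
  have h := (convexOn_finset_sum hS Finset.univ
    fun k _ => convexOn_mul_apply hS (-a k) (i k)).neg
  exact h.congr fun y _ => by simp

theorem concaveOn_mul_const {S : Set ℝ} (hS : Convex ℝ S) (z : ℝ) :
    ConcaveOn ℝ S fun t => z * t := by
  refine ⟨hS, fun x _ y _ s t _ _ _ => le_of_eq ?_⟩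
  simp only [smul_eq_mul]
  ring

theorem ConvexOn.mul_comp_div {φ : ℝ → ℝ} (hφ : ConvexOn ℝ (Set.Ici 0) φ) {p : ℝ} (hp : 0 < p) :
    ConvexOn ℝ (Set.Ici 0) fun t => p * φ (t / p) := by
  have h1 := ((hφ.comp_linearMap (LinearMap.mulRight ℝ p⁻¹)).subset
    (fun t (ht : 0 ≤ t) => show 0 ≤ t * p⁻¹ by positivity) (convex_Ici 0)).smul hp.le
  exact h1.congr fun t _ => by simp [div_eq_mul_inv]

theorem EReal.coe_finset_sum {ι : Type*} (s : Finset ι) (f : ι → ℝ) :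
    ((∑ i ∈ s, f i : ℝ) : EReal) = ∑ i ∈ s, (f i : EReal) :=
  map_sum (⟨⟨Real.toEReal, EReal.coe_zero⟩, EReal.coe_add⟩ : ℝ →+ EReal) f s

theorem sum_le_of_forall_proper {m N : ℕ} (I : Fin N ≃ ProperSubset m) {h : ℝ → ℝ}
    (hh : IsDistortion h) {q q' : Fin m → ℝ} (hq : ∑ i, q i = 1) (hq' : ∑ i, q' i = 1)
    (H : ∀ j, ∑ k ∈ (I j).1, q' k ≤ h (∑ k ∈ (I j).1, q k)) (J : Finset (Fin m)) :
    ∑ i ∈ J, q' i ≤ h (∑ i ∈ J, q i) := by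
  by_cases h1 : J = ∅
  · simp [h1, hh.map_zero]
  by_cases h2 : J = Finset.univ
  · simp [h2, hq, hq', hh.map_one]
  simpa using H (I.symm ⟨J, h1, h2⟩)

theorem sum_proper_pos_lt_one {m : ℕ} {p : Fin m → ℝ} (hp : ∀ i, 0 < p i) (hp1 : ∑ i, p i = 1)
    (J : ProperSubset m) : 0 < ∑ k ∈ J.1, p k ∧ ∑ k ∈ J.1, p k < 1 := by
  obtain ⟨J, h1, h2⟩ := J
  refine ⟨Finset.sum_pos (fun i _ => hp i) (Finset.nonempty_iff_ne_empty.2 h1), ?_⟩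
  rw [← hp1]
  obtain ⟨i, hi⟩ : ∃ i, i ∉ J := by
    by_contra hcon
    push Not at hcon
    exact h2 (Finset.eq_univ_iff_forall.2 hcon)
  exact Finset.sum_lt_sum_of_subset (Finset.subset_univ J) (Finset.mem_univ i) hi (hp i)
    fun k _ _ => (hp k).le

theorem extendDistortion_of_le {h : ℝ → ℝ} {t : ℝ} (ht : t ≤ 1) : extendDistortion h t = h t :=
  if_pos ht

theorem sum_subset_le_one {m : ℕ} {q : Fin m → ℝ} (hq : ∀ i, 0 ≤ q i) (hq1 : ∑ i, q i = 1)
    (J : Finset (Fin m)) : ∑ i ∈ J, q i ≤ 1 :=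
  hq1 ▸ Finset.sum_le_sum_of_subset_of_nonneg (Finset.subset_univ J) fun i _ _ => hq i

theorem self_mem_compositeSet {m : ℕ} {φ h : ℝ → ℝ} {r : ℝ} {p : Fin m → ℝ}
    (hφ : IsDivergenceFunction φ) (hp : ∀ i, 0 < p i) (hp1 : ∑ i, p i = 1) (hr : 0 < r)
    (hid : ∀ s, 0 ≤ s → s ≤ 1 → h s = s) : (p, p) ∈ compositeSet φ h r p := by
  refine ⟨hp1, hp1, ?_, fun J => ?_, fun i => ⟨(hp i).le, (hp i).le⟩⟩
  · simp [div_self (hp _).ne', hφ.map_one, hr.le]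
  · exact (hid _ (Finset.sum_nonneg fun i _ => (hp i).le)
      (sum_subset_le_one (fun i => (hp i).le) hp1 J)).ge

theorem two_le_of_sum_mul_le {m : ℕ} {p w : Fin m → ℝ} {c : ℝ} (hp1 : ∑ i, p i = 1)
    (hsum : ∑ i, p i * w i ≤ c) {i₀ : Fin m} (hi₀ : c < w i₀) : 2 ≤ m := by
  by_contra hm
  have : Subsingleton (Fin m) := Fin.subsingleton_iff_le_one.2 (by omega)
  have h1 : ∑ i, p i * w i = w i₀ := by
    rw [← one_mul (w i₀), ← hp1, Finset.sum_mul]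
    exact Finset.sum_congr rfl fun i _ => by rw [Subsingleton.elim i i₀]
  linarith

/-! ### Strong duality for the composite set -/

/-- Multipliers `(α, β, γ, ν, lam)` together with upper bounds of all the separate suprema of the
Lagrangian, whose total does not exceed `c`. -/
structure IsBoundedLagrangian {m N : ℕ} (φ h : ℝ → ℝ) (r : ℝ) (p w : Fin m → ℝ)
    (I : Fin N ≃ ProperSubset m) (c α β γ : ℝ) (ν lam : Fin N → ℝ) (s₁ s₂ : Fin m → ℝ)
    (s₃ : Fin N → ℝ) : Prop where
  gamma_nonneg : 0 ≤ γ
  lam_nonneg : ∀ j, 0 ≤ lam j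
  le₁ : ∀ i t, 0 ≤ t → (-α + ∑ j with i ∈ (I j).1, ν j) * t - γ * (p i * φ (t / p i)) ≤ s₁ i
  le₂ : ∀ i t, 0 ≤ t → (w i - β - ∑ j with i ∈ (I j).1, lam j) * t ≤ s₂ i
  le₃ : ∀ j t, 0 ≤ t → -ν j * t + lam j * extendDistortion h t ≤ s₃ j
  sum_le : ∑ i, s₁ i + ∑ i, s₂ i + ∑ j, s₃ j ≤ c - α - β - γ * r

theorem exists_isBoundedLagrangian_of_lt {m N : ℕ} {φ h : ℝ → ℝ} {r : ℝ} {p w : Fin m → ℝ}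
    (hh : IsDistortion h) (hconc : ConcaveOn ℝ (Set.Icc 0 1) h) (hφ : IsDivergenceFunction φ)
    (hp : ∀ i, 0 < p i) (hp1 : ∑ i, p i = 1) (hr : 0 < r) (I : Fin N ≃ ProperSubset m) {c : ℝ}
    (hlt : ∀ s, 0 < s → s < 1 → s < h s)
    (hsup : ∀ z ∈ compositeSet φ h r p, ∑ i, z.2 i * w i ≤ c) (i₀ : Fin m) :
    ∃ α β γ ν lam s₁ s₂ s₃, IsBoundedLagrangian φ h r p w I c α β γ ν lam s₁ s₂ s₃ := by
  classical
  have hext := hh.concaveOn_extendDistortion hconc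
  have hS := convex_setOf_forall_pos (Fin m ⊕ Fin m ⊕ Fin N)
  -- The coordinates are `q`, `q̄` and one auxiliary variable per proper subset. The equalities fix
  -- both total masses and tie each auxiliary variable to its sum of `q`; their multipliers become
  -- `α`, `β`, `ν`.
  let A : (Fin m ⊕ Fin m ⊕ Fin N → ℝ) →ₗ[ℝ] (Option (Option (Fin N)) → ℝ) :=
    { toFun := fun y k => k.elim (∑ i, y (.inl i)) fun k => k.elim (∑ i, y (.inr (.inl i)))
        fun j => y (.inr (.inr j)) - ∑ i ∈ (I j).1, y (.inl i)
      map_add' := fun y y' => by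
        ext k
        rcases k with _ | _ | j <;> simp [Finset.sum_add_distrib]
        ring
      map_smul' := fun a y => by
        ext k
        rcases k with _ | _ | j <;> simp [Finset.mul_sum, mul_sub] }
  have hA : Function.Surjective A := by
    intro v
    refine ⟨Sum.elim (Pi.single i₀ (v none)) (Sum.elim (Pi.single i₀ (v (some none)))
      fun j => v (some (some j)) + ∑ i ∈ (I j).1, Pi.single i₀ (v none) i), ?_⟩
    ext k
    rcases k with _ | _ | j <;> simp [A]
  let b : Option (Option (Fin N)) → ℝ := fun k => k.elim 1 fun k => k.elim 1 fun _ => 0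
  let g : Option (Fin N) → (Fin m ⊕ Fin m ⊕ Fin N → ℝ) → ℝ := fun k y =>
    k.elim (∑ i, p i * φ (y (.inl i) / p i) - r)
      fun j => ∑ i ∈ (I j).1, y (.inr (.inl i)) - extendDistortion h (y (.inr (.inr j)))
  have hg : ∀ k, ConvexOn ℝ {y : Fin m ⊕ Fin m ⊕ Fin N → ℝ | ∀ i, 0 < y i} (g k) := by
    rintro (_ | j)
    · exact (convexOn_finset_sum hS _ fun i _ =>
        (hφ.convexOn.mul_comp_div (hp i)).comp_apply_of_pos _).sub (concaveOn_const r hS)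
    · have h1 := (hext.neg.comp_apply_of_pos (ι := Fin m ⊕ Fin m ⊕ Fin N) (.inr (.inr j))).neg
      simp only [Pi.neg_apply] at h1
      have h2 := (convexOn_finset_sum hS (I j).1
        fun i _ => convexOn_mul_apply hS 1 (.inr (.inl i))).sub h1
      exact h2.congr fun y _ => by simp [g]
  have hlt' : ∀ j, ∑ k ∈ (I j).1, p k < h (∑ k ∈ (I j).1, p k) := fun j =>
    hlt _ (sum_proper_pos_lt_one hp hp1 (I j)).1 (sum_proper_pos_lt_one hp hp1 (I j)).2
  obtain ⟨η, μ, hμ, H⟩ := exists_lagrange_multipliers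
    (f := fun y : Fin m ⊕ Fin m ⊕ Fin N → ℝ => ∑ i, y (.inr (.inl i)) * w i)
    (concaveOn_sum_mul_apply hS w _) hg A hA b c
    (y₀ := Sum.elim p (Sum.elim p fun j => ∑ k ∈ (I j).1, p k))
    (by
      rintro (i | i | j)
      exacts [hp i, hp i, (sum_proper_pos_lt_one hp hp1 (I j)).1])
    (by
      ext k
      rcases k with _ | _ | j <;> simp [A, b, hp1])
    (by
      rintro (_ | j)
      · simp [g, div_self (hp _).ne', hφ.map_one, hr]
      · simp [g, extendDistortion_of_le (sum_proper_pos_lt_one hp hp1 (I j)).2.le, hlt' j])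
    (by
      intro y hy hAy hgy
      have e1 : ∑ i, y (.inl i) = 1 := congrFun hAy none
      have e2 : ∑ i, y (.inr (.inl i)) = 1 := congrFun hAy (some none)
      have e3 : ∀ j, y (.inr (.inr j)) - ∑ i ∈ (I j).1, y (.inl i) = 0 :=
        fun j => congrFun hAy (some (some j))
      refine hsup (fun i => y (.inl i), fun i => y (.inr (.inl i)))
        ⟨e1, e2, ?_, sum_le_of_forall_proper I hh e1 e2 fun j => ?_,
          fun i => ⟨(hy _).le, (hy _).le⟩⟩
      · have := hgy none
        simp only [g, Option.elim] at this
        linarith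
      · have := hgy (some j)
        simp only [g, Option.elim] at this
        rw [sub_eq_zero.1 (e3 j), extendDistortion_of_le
          (sum_subset_le_one (fun i => (hy _).le) e1 _)] at this
        linarith)
  set α := η none
  set β := η (some none)
  set ν : Fin N → ℝ := fun j => η (some (some j))
  set γ := μ none
  set lam : Fin N → ℝ := fun j => μ (some j)
  obtain ⟨s, hs, hsum⟩ := exists_upper_bounds_of_concaveOn
    (Sum.elim (fun i t => (-α + ∑ j with i ∈ (I j).1, ν j) * t - γ * (p i * φ (t / p i)))
      (Sum.elim (fun i t => (w i - β - ∑ j with i ∈ (I j).1, lam j) * t)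
        fun j t => -ν j * t + lam j * extendDistortion h t))
    (c - α - β - γ * r)
    (by
      rintro (i | i | j)
      · exact (concaveOn_mul_const (convex_Ici 0) _).sub
          ((hφ.convexOn.mul_comp_div (hp i)).smul (hμ none))
      · exact concaveOn_mul_const (convex_Ici 0) _
      · exact (concaveOn_mul_const (convex_Ici 0) _).add (hext.smul (hμ (some j))))
    (by
      intro y hy
      have h1 := H y hy
      simp only [Fintype.sum_option, A, b, g, LinearMap.coe_mk, AddHom.coe_mk, Option.elim,
        sub_zero] at h1
      have h2 := sum_mul_sum_eq_sum_mul_sum_filter (fun j => (I j).1) ν (fun i => y (.inl i))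
      have h3 := sum_mul_sum_eq_sum_mul_sum_filter (fun j => (I j).1) lam
        (fun i => y (.inr (.inl i)))
      simp only [Fintype.sum_sum_type, Sum.elim_inl, Sum.elim_inr, add_mul, sub_mul,
        Finset.sum_add_distrib, Finset.sum_sub_distrib, ← Finset.mul_sum, neg_mul,
        Finset.sum_neg_distrib]
      simp only [mul_sub, Finset.sum_sub_distrib] at h1
      simp only [mul_comm (y _)] at h1 h2 h3
      linarith)
  refine ⟨α, β, γ, ν, lam, fun i => s (.inl i), fun i => s (.inr (.inl i)),
    fun j => s (.inr (.inr j)), hμ none, fun j => hμ (some j), fun i => hs (.inl i),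
    fun i => hs (.inr (.inl i)), fun j => hs (.inr (.inr j)), ?_⟩
  simpa [Fintype.sum_sum_type, add_assoc] using hsum

/-- With `h` the identity, duality is applied to `q` alone. Taking `ν = lam` on singletons then
transfers `w i - β` from the `q̄` block to the `q` block. -/
theorem exists_isBoundedLagrangian_of_eq {m N : ℕ} {φ h : ℝ → ℝ} {r : ℝ} {p w : Fin m → ℝ}
    (hφ : IsDivergenceFunction φ)
    (hp : ∀ i, 0 < p i) (hp1 : ∑ i, p i = 1) (hr : 0 < r) (I : Fin N ≃ ProperSubset m) {c : ℝ}
    (hid : ∀ s, 0 ≤ s → s ≤ 1 → h s = s)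
    (hsup : ∀ z ∈ compositeSet φ h r p, ∑ i, z.2 i * w i ≤ c) {i₀ : Fin m} (hi₀ : c < w i₀) :
    ∃ α β γ ν lam s₁ s₂ s₃, IsBoundedLagrangian φ h r p w I c α β γ ν lam s₁ s₂ s₃ := by
  classical
  have hm : 2 ≤ m := two_le_of_sum_mul_le hp1
    (hsup _ (self_mem_compositeSet hφ hp hp1 hr hid)) hi₀
  have hS := convex_setOf_forall_pos (Fin m)
  let A : (Fin m → ℝ) →ₗ[ℝ] (Unit → ℝ) :=
    { toFun := fun y _ => ∑ i, y i
      map_add' := fun y y' => by ext; simp [Finset.sum_add_distrib]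
      map_smul' := fun a y => by ext; simp [Finset.mul_sum] }
  have hA : Function.Surjective A := fun v => ⟨Pi.single i₀ (v ()), by ext; simp [A]⟩
  obtain ⟨η, μ, hμ, H⟩ := exists_lagrange_multipliers (κ := Unit)
    (f := fun y : Fin m → ℝ => ∑ i, y i * w i) (concaveOn_sum_mul_apply hS w _)
    (g := fun _ y => ∑ i, p i * φ (y i / p i) - r)
    (fun _ => (convexOn_finset_sum hS _ fun i _ =>
        (hφ.convexOn.mul_comp_div (hp i)).comp_apply_of_pos _).sub (concaveOn_const r hS))
    A hA 1 c hp (by ext; simp [A, hp1]) (fun _ => by simp [div_self (hp _).ne', hφ.map_one, hr])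
    (by
      intro y hy hAy hgy
      have e1 : ∑ i, y i = 1 := congrFun hAy ()
      exact hsup (y, y) ⟨e1, e1, by linarith [hgy ()], fun J =>
        (hid _ (Finset.sum_nonneg fun i _ => (hy i).le)
          (sum_subset_le_one (fun i => (hy i).le) e1 J)).ge,
        fun i => ⟨(hy i).le, (hy i).le⟩⟩)
  obtain ⟨s, hs, hsum⟩ := exists_upper_bounds_of_concaveOn
    (fun i t => (w i - η ()) * t - μ () * (p i * φ (t / p i))) (c - η () - μ () * r)
    (fun i => (concaveOn_mul_const (convex_Ici 0) _).sub
      ((hφ.convexOn.mul_comp_div (hp i)).smul (hμ ())))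
    (by
      intro y hy
      have h1 := H y hy
      simp only [Finset.univ_unique, Finset.sum_singleton, A, LinearMap.coe_mk, AddHom.coe_mk,
        Pi.one_apply, PUnit.default_eq_unit] at h1
      simp only [sub_mul, Finset.sum_sub_distrib, ← Finset.mul_sum]
      simp only [mul_comm (y _)] at h1
      linarith)
  -- Any `β` below every `w i` serves: the singleton weights `w i - β` must be nonnegative.
  set β : ℝ := -∑ i, |w i|
  have hβ : ∀ i, 0 ≤ w i - β := fun i => by
    have h1 := Finset.single_le_sum (f := fun i => |w i|) (fun i _ => abs_nonneg _)
      (Finset.mem_univ i)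
    have h2 := neg_abs_le (w i)
    simp only [β] at h1 ⊢
    linarith
  obtain ⟨lam, hlam, hlamsum⟩ := exists_singleton_weights hm I hβ
  -- With `α = η () - β`, the `q` coefficient becomes `w i - η ()`, `β` cancels from the total, and
  -- the other two blocks are bounded by `0`.
  refine ⟨η () - β, β, μ (), lam, lam, s, 0, 0, hμ (), hlam, fun i t ht => ?_, fun i t _ => ?_,
    fun j t ht => ?_, ?_⟩
  · rw [hlamsum]
    refine le_trans (le_of_eq ?_) (hs i t ht)
    ring
  · simp [hlamsum]
  · have h1 : extendDistortion h t ≤ t := by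
      unfold extendDistortion
      split_ifs with h1
      · exact (hid t ht h1).le
      · linarith
    have := mul_le_mul_of_nonneg_left h1 (hlam j)
    simp only [Pi.zero_apply]
    linarith
  · simp only [Pi.zero_apply, Finset.sum_const_zero]
    linarith

/-- Without the divergence term, the Lagrangian can be evaluated at the vertex `q = q̄ = e_i`, with
auxiliary variable `1` exactly when the subset contains `i`. All multipliers cancel there. -/
theorem IsBoundedLagrangian.le_of_gamma_eq_zero {m N : ℕ} {φ h : ℝ → ℝ} {r : ℝ} {p w : Fin m → ℝ}
    {I : Fin N ≃ ProperSubset m} {c α β : ℝ} {ν lam : Fin N → ℝ} {s₁ s₂ : Fin m → ℝ}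
    {s₃ : Fin N → ℝ} (hh : IsDistortion h)
    (H : IsBoundedLagrangian φ h r p w I c α β 0 ν lam s₁ s₂ s₃) (i : Fin m) : w i ≤ c := by
  classical
  have h1 : (-α + ∑ j with i ∈ (I j).1, ν j) ≤ ∑ k, s₁ k := by
    rw [← Finset.add_sum_erase _ _ (Finset.mem_univ i)]
    have e1 := H.le₁ i 1 zero_le_one
    have e2 := Finset.sum_nonneg fun k (_ : k ∈ Finset.univ.erase i) =>
      show 0 ≤ s₁ k by simpa using H.le₁ k 0 le_rfl
    linarith
  have h2 : (w i - β - ∑ j with i ∈ (I j).1, lam j) ≤ ∑ k, s₂ k := by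
    rw [← Finset.add_sum_erase _ _ (Finset.mem_univ i)]
    have e1 := H.le₂ i 1 zero_le_one
    have e2 := Finset.sum_nonneg fun k (_ : k ∈ Finset.univ.erase i) =>
      show 0 ≤ s₂ k by simpa using H.le₂ k 0 le_rfl
    linarith
  have h3 : -∑ j with i ∈ (I j).1, ν j + ∑ j with i ∈ (I j).1, lam j ≤ ∑ j, s₃ j := by
    rw [Finset.sum_filter, Finset.sum_filter, ← Finset.sum_neg_distrib, ← Finset.sum_add_distrib]
    refine Finset.sum_le_sum fun j _ => ?_
    by_cases hj : i ∈ (I j).1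
    · simpa [hj, extendDistortion, hh.map_one] using H.le₃ j 1 zero_le_one
    · simpa [hj, extendDistortion, hh.map_zero] using H.le₃ j 0 le_rfl
  have h4 := H.sum_le
  linarith

theorem IsBoundedLagrangian.exists_dual {m N : ℕ} {φ h : ℝ → ℝ} {r : ℝ} {p w : Fin m → ℝ}
    {I : Fin N ≃ ProperSubset m} {c α β γ : ℝ} {ν lam : Fin N → ℝ} {s₁ s₂ : Fin m → ℝ}
    {s₃ : Fin N → ℝ} (hp : ∀ i, 0 < p i) (hγ : 0 < γ)
    (H : IsBoundedLagrangian φ h r p w I c α β γ ν lam s₁ s₂ s₃) :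
    ∃ (α β γ : ℝ) (ν lam : Fin N → ℝ),
      ((α + β + γ * r : ℝ) : EReal)
        + ∑ i, (p i : EReal) *
            perspective (conjugate (Set.Ici 0) φ) (-α + ∑ j with i ∈ (I j).1, ν j) γ
        + ∑ j, perspective (conjugate (Set.Ici 0) (fun t => -extendDistortion h t))
            (-(ν j)) (lam j) ≤ (c : EReal) ∧
      (∀ i, w i - β - ∑ j with i ∈ (I j).1, lam j ≤ 0) ∧ (∀ j, 0 ≤ lam j) ∧ 0 ≤ γ := by
  classical
  -- When `lam j = 0`, boundedness of `-ν j * t` forces `0 ≤ ν j`. Resetting it to `0` meets the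
  -- convention and only lowers the slopes in the `φ` terms, harmless since `t ≥ 0`.
  set ν' : Fin N → ℝ := fun j => if lam j = 0 then 0 else ν j with hν'
  have hle : ∀ j, ν' j ≤ ν j := fun j => by
    by_cases h0 : lam j = 0
    · have := nonpos_of_forall_mul_le (w := -ν j) (s := s₃ j)
        fun t ht => by simpa [h0] using H.le₃ j t ht
      simp only [hν', h0, if_true]
      linarith
    · simp [hν', h0]
  refine ⟨α, β, γ, ν', lam, ?_, fun i => nonpos_of_forall_mul_le (H.le₂ i), H.lam_nonneg, hγ.le⟩
  have h1 : ∀ i, (p i : EReal) * perspective (conjugate (Set.Ici 0) φ)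
      (-α + ∑ j with i ∈ (I j).1, ν' j) γ ≤ (s₁ i : EReal) := fun i => by
    have h2 : perspective (conjugate (Set.Ici 0) φ) (-α + ∑ j with i ∈ (I j).1, ν' j) γ
        ≤ ((s₁ i / p i : ℝ) : EReal) := by
      refine perspective_conjugate_le hγ fun t ht => ?_
      have ht : 0 ≤ t := ht
      rw [le_div_iff₀ (hp i)]
      -- Rescaling by `p i` turns the bound on `p i * φ (t / p i)` into one on the conjugate of `φ`.
      have h3 := H.le₁ i (p i * t) (mul_nonneg (hp i).le ht)
      rw [mul_div_cancel_left₀ _ (hp i).ne'] at h3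
      have h4 : ∑ j with i ∈ (I j).1, ν' j ≤ ∑ j with i ∈ (I j).1, ν j :=
        Finset.sum_le_sum fun j _ => hle j
      nlinarith [mul_le_mul_of_nonneg_right h4 (mul_nonneg (hp i).le ht)]
    refine (mul_le_mul_of_nonneg_left h2 (EReal.coe_nonneg.2 (hp i).le)).trans (le_of_eq ?_)
    rw [← EReal.coe_mul, mul_div_cancel₀ _ (hp i).ne']
  have h2 : ∀ j, perspective (conjugate (Set.Ici 0) (fun t => -extendDistortion h t))
      (-(ν' j)) (lam j) ≤ (s₃ j : EReal) := fun j => by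
    by_cases h0 : lam j = 0
    · have h3 := H.le₃ j 0 le_rfl
      simp only [h0, mul_zero, zero_mul, add_zero] at h3
      simpa [hν', h0, perspective_zero_zero] using h3
    · refine perspective_conjugate_le ((H.lam_nonneg j).lt_of_ne' h0) fun t ht => ?_
      have h3 := H.le₃ j t ht
      simp only [hν', h0, if_false]
      linarith
  have h3 : 0 ≤ ∑ i, s₂ i :=
    Finset.sum_nonneg fun i _ => by simpa using H.le₂ i 0 le_rfl
  refine (add_le_add (add_le_add le_rfl (Finset.sum_le_sum fun i _ => h1 i))
    (Finset.sum_le_sum fun j _ => h2 j)).trans ?_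
  rw [← EReal.coe_finset_sum, ← EReal.coe_finset_sum, ← EReal.coe_add, ← EReal.coe_add,
    EReal.coe_le_coe_iff]
  linarith [H.sum_le]

/-! ### Weak duality and the equivalence for the composite set -/

theorem sum_mul_le_of_dual {m N : ℕ} {φ h : ℝ → ℝ} {r : ℝ} {p w : Fin m → ℝ}
    (hp : ∀ i, 0 < p i) (I : Fin N ≃ ProperSubset m) {c α β γ : ℝ} {ν lam : Fin N → ℝ}
    (H : ((α + β + γ * r : ℝ) : EReal)
        + ∑ i, (p i : EReal) *
            perspective (conjugate (Set.Ici 0) φ) (-α + ∑ j with i ∈ (I j).1, ν j) γ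
        + ∑ j, perspective (conjugate (Set.Ici 0) (fun t => -extendDistortion h t))
            (-(ν j)) (lam j) ≤ (c : EReal))
    (hw : ∀ i, w i - β - ∑ j with i ∈ (I j).1, lam j ≤ 0) (hlam : ∀ j, 0 ≤ lam j) (hγ : 0 ≤ γ)
    {z : (Fin m → ℝ) × (Fin m → ℝ)} (hz : z ∈ compositeSet φ h r p) :
    ∑ i, z.2 i * w i ≤ c := by
  obtain ⟨q, q'⟩ := z
  obtain ⟨e1, e2, e3, e4, e5⟩ := hz
  simp only at e1 e2 e3 e4 e5 ⊢
  have h1 : ∀ i, ((p i * ((-α + ∑ j with i ∈ (I j).1, ν j) * (q i / p i) - γ * φ (q i / p i)) : ℝ)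
      : EReal) ≤ (p i : EReal) * perspective (conjugate (Set.Ici 0) φ)
        (-α + ∑ j with i ∈ (I j).1, ν j) γ := fun i => by
    rw [EReal.coe_mul]
    exact mul_le_mul_of_nonneg_left (le_perspective_conjugate _ _ hγ
      (div_nonneg (e5 i).1 (hp i).le)) (EReal.coe_nonneg.2 (hp i).le)
  have h2 : ∀ j, ((-ν j * (∑ k ∈ (I j).1, q k) -
      lam j * -extendDistortion h (∑ k ∈ (I j).1, q k) : ℝ) : EReal) ≤
      perspective (conjugate (Set.Ici 0) (fun t => -extendDistortion h t)) (-(ν j)) (lam j) :=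
    fun j => le_perspective_conjugate (Set.Ici 0) (fun t => -extendDistortion h t) (hlam j) (Finset.sum_nonneg fun k _ => (e5 k).1)
  have h3 := (add_le_add (add_le_add le_rfl (Finset.sum_le_sum fun i (_ : i ∈ Finset.univ) => h1 i))
    (Finset.sum_le_sum fun j (_ : j ∈ Finset.univ) => h2 j)).trans H
  rw [← EReal.coe_finset_sum, ← EReal.coe_finset_sum, ← EReal.coe_add, ← EReal.coe_add,
    EReal.coe_le_coe_iff] at h3
  have h4 : ∀ i, p i * ((-α + ∑ j with i ∈ (I j).1, ν j) * (q i / p i) - γ * φ (q i / p i)) =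
      -(q i * α) + q i * ∑ j with i ∈ (I j).1, ν j - γ * (p i * φ (q i / p i)) := fun i => by
    have := (hp i).ne'
    field_simp
  have h5 : ∑ j, lam j * ∑ k ∈ (I j).1, q' k ≤
      ∑ j, lam j * extendDistortion h (∑ k ∈ (I j).1, q k) := by
    refine Finset.sum_le_sum fun j _ => mul_le_mul_of_nonneg_left ?_ (hlam j)
    rw [extendDistortion_of_le (sum_subset_le_one (fun i => (e5 i).1) e1 _)]
    exact e4 _
  have h6 : ∑ i, q' i * w i ≤ ∑ i, (q' i * β + q' i * ∑ j with i ∈ (I j).1, lam j) :=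
    Finset.sum_le_sum fun i _ => by nlinarith [mul_le_mul_of_nonneg_left (hw i) (e5 i).2]
  simp only [h4, Finset.sum_add_distrib, Finset.sum_sub_distrib, ← Finset.mul_sum,
    Finset.sum_neg_distrib, ← Finset.sum_mul, neg_mul, mul_neg, sub_neg_eq_add] at h3 h6
  rw [← sum_mul_sum_eq_sum_mul_sum_filter (fun j => (I j).1), e1] at h3
  rw [← sum_mul_sum_eq_sum_mul_sum_filter (fun j => (I j).1), e2] at h6
  have h7 := mul_le_mul_of_nonneg_left e3 hγ
  linarith

theorem forall_compositeSet_iff_exists_dual {m N : ℕ} {φ h : ℝ → ℝ} {r : ℝ} {p w : Fin m → ℝ}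
    (hh : IsDistortion h) (hconc : ConcaveOn ℝ (Set.Icc 0 1) h) (hφ : IsDivergenceFunction φ)
    (hp : ∀ i, 0 < p i) (hp1 : ∑ i, p i = 1) (hr : 0 < r) (I : Fin N ≃ ProperSubset m) {c : ℝ} :
    (∀ z ∈ compositeSet φ h r p, ∑ i, z.2 i * w i ≤ c) ↔
    ∃ (α β γ : ℝ) (ν lam : Fin N → ℝ),
      ((α + β + γ * r : ℝ) : EReal)
        + ∑ i, (p i : EReal) *
            perspective (conjugate (Set.Ici 0) φ) (-α + ∑ j with i ∈ (I j).1, ν j) γ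
        + ∑ j, perspective (conjugate (Set.Ici 0) (fun t => -extendDistortion h t))
            (-(ν j)) (lam j) ≤ (c : EReal) ∧
      (∀ i, w i - β - ∑ j with i ∈ (I j).1, lam j ≤ 0) ∧ (∀ j, 0 ≤ lam j) ∧ 0 ≤ γ := by
  refine ⟨fun hsup => ?_, fun ⟨α, β, γ, ν, lam, H, hw, hlam, hγ⟩ z hz =>
    sum_mul_le_of_dual hp I H hw hlam hγ hz⟩
  by_cases hwc : ∀ i, w i ≤ c
  -- With `β = c` and all other multipliers zero, every perspective is at `(0, 0)` and vanishes.
  · refine ⟨0, c, 0, 0, 0, ?_, fun i => by simpa using hwc i, fun j => le_rfl, le_rfl⟩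
    simp [perspective_zero_zero]
  push Not at hwc
  obtain ⟨i₀, hi₀⟩ := hwc
  obtain ⟨α, β, γ, ν, lam, s₁, s₂, s₃, H⟩ :
      ∃ α β γ ν lam s₁ s₂ s₃, IsBoundedLagrangian φ h r p w I c α β γ ν lam s₁ s₂ s₃ := by
    rcases hh.lt_or_eq hconc with hlt | hid
    · exact exists_isBoundedLagrangian_of_lt hh hconc hφ hp hp1 hr I hlt hsup i₀
    · exact exists_isBoundedLagrangian_of_eq hφ hp hp1 hr I hid hsup hi₀
  rcases H.gamma_nonneg.eq_or_lt with rfl | hγ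
  · exact absurd (H.le_of_gamma_eq_zero hh i₀) (not_le.2 hi₀)
  · exact H.exists_dual hp hγ

/-! ### Duality for the distortion set -/

theorem exists_dual_of_forall_distortionSet {m N : ℕ} {h : ℝ → ℝ} {p w : Fin m → ℝ}
    (hh : IsDistortion h) (hconc : ConcaveOn ℝ (Set.Icc 0 1) h)
    (hp : ∀ i, 0 < p i) (hp1 : ∑ i, p i = 1) (I : Fin N ≃ ProperSubset m) {c : ℝ}
    (hsup : ∀ q ∈ distortionSet h p, ∑ i, q i * w i ≤ c) :
    ∃ (β : ℝ) (lam : Fin N → ℝ), β + ∑ j, lam j * h (∑ k ∈ (I j).1, p k) ≤ c ∧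
      (∀ i, w i - β - ∑ j with i ∈ (I j).1, lam j ≤ 0) ∧ ∀ j, 0 ≤ lam j := by
  classical
  by_cases hwc : ∀ i, w i ≤ c
  · exact ⟨c, 0, by simp, fun i => by simpa using hwc i, fun j => le_rfl⟩
  push Not at hwc
  obtain ⟨i₀, hi₀⟩ := hwc
  rcases hh.lt_or_eq hconc with hlt | hid
  · have hS := convex_setOf_forall_pos (Fin m)
    let A : (Fin m → ℝ) →ₗ[ℝ] (Unit → ℝ) :=
      { toFun := fun y _ => ∑ i, y i
        map_add' := fun y y' => by ext; simp [Finset.sum_add_distrib]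
        map_smul' := fun a y => by ext; simp [Finset.mul_sum] }
    have hA : Function.Surjective A := fun v => ⟨Pi.single i₀ (v ()), by ext; simp [A]⟩
    obtain ⟨η, lam, hlam, H⟩ := exists_lagrange_multipliers
      (f := fun y : Fin m → ℝ => ∑ i, y i * w i) (concaveOn_sum_mul_apply hS w _)
      (g := fun j (y : Fin m → ℝ) => ∑ i ∈ (I j).1, y i * 1 - h (∑ k ∈ (I j).1, p k))
      (fun j => (convexOn_finset_sum hS _ fun i _ => convexOn_mul_apply hS 1 i).sub
        (concaveOn_const (h (∑ k ∈ (I j).1, p k)) hS))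
      A hA 1 c hp (by ext; simp [A, hp1])
      (fun j => by
        obtain ⟨h1, h2⟩ := sum_proper_pos_lt_one hp hp1 (I j)
        simpa using hlt _ h1 h2)
      (fun y hy hAy hgy => hsup y ⟨congrFun hAy (),
        sum_le_of_forall_proper I hh hp1 (congrFun hAy ()) fun j => by simpa using (hgy j).le,
        fun i => (hy i).le⟩)
    obtain ⟨s, hs, hsum⟩ := exists_upper_bounds_of_concaveOn
      (fun i t => (w i - η () - ∑ j with i ∈ (I j).1, lam j) * t)
      (c - η () - ∑ j, lam j * h (∑ k ∈ (I j).1, p k))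
      (fun i => concaveOn_mul_const (convex_Ici 0) _)
      (by
        intro y hy
        have h1 := H y hy
        have h2 := sum_mul_sum_eq_sum_mul_sum_filter (fun j => (I j).1) lam y
        simp only [Finset.univ_unique, Finset.sum_singleton, A, LinearMap.coe_mk, AddHom.coe_mk,
          Pi.one_apply, PUnit.default_eq_unit, mul_one, mul_sub, Finset.sum_sub_distrib] at h1
        simp only [sub_mul, Finset.sum_sub_distrib, ← Finset.mul_sum]
        simp only [mul_comm (y _)] at h1 h2
        linarith)
    have h3 : 0 ≤ ∑ i, s i := Finset.sum_nonneg fun i _ => by simpa using hs i 0 le_rfl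
    exact ⟨η (), lam, by linarith, fun i => nonpos_of_forall_mul_le (hs i), hlam⟩
  · have hp0 : ∀ i, 0 ≤ p i := fun i => (hp i).le
    have hpJ : ∀ J : Finset (Fin m), h (∑ k ∈ J, p k) = ∑ k ∈ J, p k := fun J =>
      hid _ (Finset.sum_nonneg fun i _ => hp0 i) (sum_subset_le_one hp0 hp1 J)
    have hpw := hsup p ⟨hp1, fun J => (hpJ J).ge, hp0⟩
    -- Here too `β` only makes the singleton weights nonnegative. It cancels from the dual value,
    -- which is the nominal mean `∑ i, p i * w i`.
    set β : ℝ := -∑ i, |w i|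
    have hβ : ∀ i, 0 ≤ w i - β := fun i => by
      have h1 := Finset.single_le_sum (f := fun i => |w i|) (fun i _ => abs_nonneg _)
        (Finset.mem_univ i)
      have h2 := neg_abs_le (w i)
      simp only [β] at h1 ⊢
      linarith
    obtain ⟨lam, hlam, hlamsum⟩ :=
      exists_singleton_weights (two_le_of_sum_mul_le hp1 hpw hi₀) I hβ
    refine ⟨β, lam, ?_, fun i => by simp [hlamsum], hlam⟩
    simp only [hpJ]
    rw [sum_mul_sum_eq_sum_mul_sum_filter (fun j => (I j).1)]
    simp only [hlamsum, mul_sub, Finset.sum_sub_distrib, ← Finset.sum_mul, hp1]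
    linarith

theorem sum_mul_le_of_distortionSet_dual {m N : ℕ} {h : ℝ → ℝ} {p w : Fin m → ℝ}
    (I : Fin N ≃ ProperSubset m) {c β : ℝ} {lam : Fin N → ℝ}
    (H : β + ∑ j, lam j * h (∑ k ∈ (I j).1, p k) ≤ c)
    (hw : ∀ i, w i - β - ∑ j with i ∈ (I j).1, lam j ≤ 0) (hlam : ∀ j, 0 ≤ lam j)
    {q : Fin m → ℝ} (hq : q ∈ distortionSet h p) : ∑ i, q i * w i ≤ c := by
  obtain ⟨e1, e2, e3⟩ := hq
  have h5 : ∑ j, lam j * ∑ k ∈ (I j).1, q k ≤ ∑ j, lam j * h (∑ k ∈ (I j).1, p k) :=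
    Finset.sum_le_sum fun j _ => mul_le_mul_of_nonneg_left (e2 _) (hlam j)
  have h6 : ∑ i, q i * w i ≤ ∑ i, (q i * β + q i * ∑ j with i ∈ (I j).1, lam j) :=
    Finset.sum_le_sum fun i _ => by nlinarith [mul_le_mul_of_nonneg_left (hw i) (e3 i)]
  rw [Finset.sum_add_distrib, ← Finset.sum_mul, e1,
    ← sum_mul_sum_eq_sum_mul_sum_filter (fun j => (I j).1)] at h6
  linarith

theorem theorem2 {n l m : ℕ} (h φ u : ℝ → ℝ) (f : (Fin n → ℝ) → (Fin l → ℝ) → ℝ)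
    (x : Fin m → (Fin l → ℝ)) (p : Fin m → ℝ) (r : ℝ)
    (hh : IsDistortion h) (hconc : ConcaveOn ℝ (Set.Icc 0 1) h)
    (hφ : IsDivergenceFunction φ)
    (hp_pos : ∀ i, 0 < p i) (hp_sum : ∑ i, p i = 1) (hr : 0 < r)
    (I : Fin (2 ^ m - 2) ≃ ProperSubset m)
    (a : Fin n → ℝ) (c : ℝ) :
    ((⨆ z ∈ compositeSet φ h r p, ((∑ i, -(z.2 i) * u (f a (x i)) : ℝ) : EReal)) ≤ (c : EReal) ↔
      ∃ (α β γ : ℝ) (ν lam : Fin (2 ^ m - 2) → ℝ),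
        ((α + β + γ * r : ℝ) : EReal)
          + ∑ i, (p i : EReal) *
              perspective (conjugate (Set.Ici 0) φ)
                (-α + ∑ j with i ∈ (I j).1, ν j) γ
          + ∑ j, perspective (conjugate (Set.Ici 0) (fun t => -extendDistortion h t))
              (-(ν j)) (lam j) ≤ (c : EReal) ∧
        (∀ i, -u (f a (x i)) - β - ∑ j with i ∈ (I j).1, lam j ≤ 0) ∧
        (∀ j, 0 ≤ lam j) ∧ 0 ≤ γ) ∧
    ((⨆ q ∈ distortionSet h p, ((∑ i, -(q i) * u (f a (x i)) : ℝ) : EReal)) ≤ (c : EReal) ↔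
      ∃ (β : ℝ) (lam : Fin (2 ^ m - 2) → ℝ),
        β + ∑ j, lam j * h (∑ k ∈ (I j).1, p k) ≤ c ∧
        (∀ i, -u (f a (x i)) - β - ∑ j with i ∈ (I j).1, lam j ≤ 0) ∧
        (∀ j, 0 ≤ lam j)) := by
  constructor
  · rw [← forall_compositeSet_iff_exists_dual hh hconc hφ hp_pos hp_sum hr I, iSup₂_le_iff]
    simp only [EReal.coe_le_coe_iff, mul_neg, neg_mul]
  · rw [iSup₂_le_iff]
    simp only [EReal.coe_le_coe_iff]
    have e : ∀ q : Fin m → ℝ, ∑ i, -(q i) * u (f a (x i)) = ∑ i, q i * -u (f a (x i)) :=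
      fun q => by simp
    simp only [e]
    exact ⟨exists_dual_of_forall_distortionSet hh hconc hp_pos hp_sum I,
      fun ⟨β, lam, H, hw, hlam⟩ q hq => sum_mul_le_of_distortionSet_dual I H hw hlam hq⟩
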